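/- Define integers $t_{i,j}(n)$ for $n\ge 1$ and $i,j\in\mathbb Z$ by $t_{2,0}(1)=1$, by the recurrence $$t_{i,j}(n)=(i-2)\,t_{i-1,j}(n-1)+t_{i-1,j-1}(n-1)+(i-3)\,t_{i-2,j}(n-1)$$ for $n\ge 2$, $n+1\le i\le 2n$ and $0\le j\le 2n-i$, and by $t_{i,j}(n)=0$ in all other cases (that is, if $i\le n$ or $j<0$ or $i+j>2n$). Let $$U(x,\sigma_1,\sigma_2,\dots)=1-\sum_{m=1}^\infty x^m\sum_{i=m+1}^{2m}\sigma_i\sum_{j=0}^{2m-i}t_{i,j}(m)(-\sigma_1)^j,$$ a formal power series in $x$ with coefficients in $\mathbb Z[\sigma_1,\sigma_2,\dots]$. Let $G$ be a finite group with $N$ elements and identity $e$. A packing of subsets $\mathcal S_1,\dots,\mathcal S_n$ of $G$ is an element $(g_1,\dots,g_n)\in G^n$ such that the left translates $g_1\mathcal S_1,\dots,g_n\mathcal S_n$ are pairwise disjoint. The family $\mathcal S_1,\dots,\mathcal S_n$ is called generic if $h_{i_1}h_{i_2}\cdots h_{i_k}\neq e$ for every $k\ge 1$, every sequence $i_1,\dots,i_k$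 of $k$ distinct elements of $\{1,\dots,n\}$ and every choice of elements $h_{i_j}\in\mathcal S_{i_j}^{-1}\mathcal S_{i_j}\setminus\{e\}$. **Theorem.** The number of packings of a generic family $\mathcal S_1,\dots,\mathcal S_n$ of $n$ non-empty subsets of a finite group $G$ with $N$ elements equals $$N^n\,U(N^{-1},\sigma_1,\sigma_2,\dots),\qquad\text{where}\quad \sum_{j=0}^\infty\sigma_jt^j=\prod_{k=1}^n\bigl(1+\#(\mathcal S_k)\,t\bigr).$$ Moreover, for all integers $s_1,\dots,s_n\ge 1$, with $\sum_j\sigma_jt^j=\prod_{k=1}^n(1+s_kt)$, the coefficient of $x^m$ in $U(x,\sigma_1,\sigma_2,\dots)$ is zero for all $m\ge\max(n,1)$, and there is a polynomial $P\in\mathbb Z[X]$ of degree $n$, depending only on $s_1,\dots,s_n$, such that $P(N)=N^nU(N^{-1},\sigma_1,\sigma_2,\dots)$ for every integer $N\ge1$, and such that every generic family $\mathcal S_1,\dots,\mathcal S_n$ with $\#(\mathcal S_k)=s_k$ for all $k$ in a finite group $G$ has exactly $P(\#(G))$ packings. -/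

import Mathlib

open scoped Pointwise

universe u

namespace GroupPacking

/-- The integers `t_{i,j}(n)`, as `t n i j`. They are zero unless `n ≥ 1`, `i > n`, `j ≥ 0` and
`i + j ≤ 2 n`. -/
def t : ℕ → ℤ → ℤ → ℤ
  | 0, _, _ => 0
  | 1, i, j => if i = 2 ∧ j = 0 then 1 else 0
  | n + 2, i, j =>
      if ((n + 2 : ℕ) : ℤ) < i ∧ 0 ≤ j ∧ i + j ≤ 2 * ((n + 2 : ℕ) : ℤ) then
        (i - 2) * t (n + 1) (i - 1) j + t (n + 1) (i - 1) (j - 1)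
          + (i - 3) * t (n + 1) (i - 2) j
      else 0

/-- The formal power series
`U = 1 - ∑_{n ≥ 1} x^n ∑_{i=n+1}^{2n} σ_i ∑_{j=0}^{2n-i} t_{i,j}(n) (-σ_1)^j`
over `ℤ[σ_1, σ_2, …]`. The indeterminate `σ_i` is `MvPolynomial.X i`; the index `0` never occurs.
For `n = 0` the range of `i` is empty, so the subtracted series has no constant term. -/
noncomputable def U : PowerSeries (MvPolynomial ℕ ℤ) :=
  1 - PowerSeries.mk fun n : ℕ =>
    ∑ i ∈ Finset.Icc (n + 1) (2 * n), MvPolynomial.X i *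
      ∑ j ∈ Finset.range (2 * n - i + 1),
        MvPolynomial.C (t n (i : ℤ) (j : ℤ)) * (-MvPolynomial.X 1) ^ j

/-- The series `U(x, σ_1, σ_2, …)` in `x` for given integer values of the `σ_i`. -/
noncomputable def specializedU (σ : ℕ → ℤ) : PowerSeries ℤ :=
  PowerSeries.map (MvPolynomial.eval σ) U

/-- The value of `U(x, σ_1, σ_2, …)` at a real number `x` and integers `σ_i`. -/
noncomputable def evalU (x : ℝ) (σ : ℕ → ℤ) : ℝ :=
  ∑' m : ℕ, ((PowerSeries.coeff m (specializedU σ) : ℤ) : ℝ) * x ^ m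

/-- The numbers `σ_j` defined by `∑_j σ_j t^j = ∏_k (1 + s_k t)`. -/
noncomputable def sigma {n : ℕ} (s : Fin n → ℕ) (j : ℕ) : ℤ :=
  (∏ k : Fin n, (1 + Polynomial.C (s k : ℤ) * Polynomial.X)).coeff j

section Group

variable {G : Type*} [Group G] {n : ℕ}

/-- `(g_1, …, g_n)` is a packing of `S_1, …, S_n` if the left translates `g_i S_i` are pairwise
disjoint. -/
def IsPacking (S : Fin n → Set G) (g : Fin n → G) : Prop :=
  Pairwise fun i j => Disjoint (g i • S i) (g j • S j)

/-- The number of packings of a family of subsets of a finite group. -/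
noncomputable def numPackings (S : Fin n → Set G) : ℕ :=
  Nat.card {g : Fin n → G // IsPacking S g}

/-- Genericity: `h_{i_1} ⋯ h_{i_k} ≠ 1` for every non-empty sequence `i_1, …, i_k` of distinct
indices and all `h_i ∈ S_i⁻¹ S_i \ {1}`. -/
def IsGeneric (S : Fin n → Set G) : Prop :=
  ∀ l : List (Fin n), l ≠ [] → l.Nodup → ∀ h : Fin n → G,
    (∀ i ∈ l, h i ∈ ((S i)⁻¹ * S i) \ {1}) → (l.map h).prod ≠ 1

end Group

end GroupPacking

/-! The count is determined by a recursion in the size of one set, and `U` satisfies the same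
recursion. Let `a ∈ S₀` and let `g₀, g` be a packing of `S₀ \ {a}, S₁, …, Sₙ`. Either it also packs
`S₀, S₁, …, Sₙ`, or `g₀ a` lies in exactly one translate `gᵢ Sᵢ`, say `g₀ a = gᵢ b`. In the second
case the two translates fuse into a translate of the set `glue S₀ Sᵢ a b`, giving a packing of `n`
sets. This is a bijection (`numPackings_cons_diff`). Genericity survives fusion
(`IsGeneric.update_glue`) and makes the fused size additive. Writing `F` for the count as a function
of the sizes, this gives `F(r+1, s) = F(r, s) - ∑ᵢ sᵢ F(s with sᵢ replaced by r + sᵢ)`, with `F(0,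
s) = N F(s)`.

On the algebraic side, put `y = -σ₁` and collect the `t_{i,j}(m)` into polynomials in `y`. The
recursion for `U` (`correction_recursion`) then follows from a difference equation in `y`
(`rowPoly_add_one_sub`) and from the effect of fusion on the `σ_k`, summed over `i`
(`sum_mul_sigma_update`). -/

namespace GroupPacking

/-! ### The numbers `t` and their row polynomials -/

theorem t_eq_zero (n : ℕ) (i j : ℤ) (h : i ≤ n ∨ j < 0 ∨ 2 * (n : ℤ) < i + j) : t n i j = 0 := by
  match n with
  | 0 => rfl
  | 1 =>
    rw [t, if_neg]
    push_cast at h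
    omega
  | n + 2 =>
    rw [t, if_neg]
    omega

theorem t_succ_succ (n : ℕ) (i j : ℤ) :
    t (n + 2) i j = (i - 2) * t (n + 1) (i - 1) j + t (n + 1) (i - 1) (j - 1)
      + (i - 3) * t (n + 1) (i - 2) j := by
  rw [t]
  split_ifs with h
  · rfl
  · rw [t_eq_zero (n + 1) (i - 1) j (by push_cast at h ⊢; omega),
      t_eq_zero (n + 1) (i - 1) (j - 1) (by push_cast at h ⊢; omega),
      t_eq_zero (n + 1) (i - 2) j (by push_cast at h ⊢; omega)]
    ring

/-- The polynomials `∑_j t_{i,j}(n) y^j`. -/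
def rowPoly : ℕ → ℤ → ℤ → ℤ
  | 0, _, _ => 0
  | 1, _, i => if i = 2 then 1 else 0
  | n + 2, y, i => (i - 2 + y) * rowPoly (n + 1) y (i - 1) + (i - 3) * rowPoly (n + 1) y (i - 2)

theorem rowPoly_of_le (n : ℕ) (y i : ℤ) (h : i ≤ n) : rowPoly n y i = 0 := by
  induction n using Nat.strong_induction_on generalizing i with
  | _ n ih =>
    match n with
    | 0 => rfl
    | 1 => rw [rowPoly, if_neg]; push_cast at h; omega
    | n + 2 =>
      rw [rowPoly, ih (n + 1) (by omega) _ (by push_cast at h ⊢; omega),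
        ih (n + 1) (by omega) _ (by push_cast at h ⊢; omega)]
      ring

theorem rowPoly_of_two_mul_lt (n : ℕ) (y i : ℤ) (h : 2 * (n : ℤ) < i) : rowPoly n y i = 0 := by
  induction n using Nat.strong_induction_on generalizing i with
  | _ n ih =>
    match n with
    | 0 => rfl
    | 1 => rw [rowPoly, if_neg]; push_cast at h; omega
    | n + 2 =>
      rw [rowPoly, ih (n + 1) (by omega) _ (by push_cast at h ⊢; omega),
        ih (n + 1) (by omega) _ (by push_cast at h ⊢; omega)]
      ring

/-- The bound says that `K` exceeds every `j` with `t n i j ≠ 0`. It is left free because the term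
in `j - 1` shortens the range by one in the induction. -/
theorem sum_t_mul_pow (n K : ℕ) (y i : ℤ) (h : 2 * (n : ℤ) < i + K) :
    ∑ j ∈ Finset.range K, t n i j * y ^ j = rowPoly n y i := by
  induction n using Nat.strong_induction_on generalizing i K with
  | _ n ih =>
    cases K with
    | zero => rw [rowPoly_of_two_mul_lt n y i (by simpa using h)]; rfl
    | succ K =>
      match n with
      | 0 => simp [t, rowPoly]
      | 1 =>
        rw [Finset.sum_range_succ', Finset.sum_eq_zero]
        · simp [t, rowPoly]
        · intro j _
          rw [t, if_neg (by push_cast; omega), zero_mul]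
      | n + 2 =>
        have h1 := ih (n + 1) (by omega) (K + 1) (i - 1) (by push_cast at h ⊢; omega)
        have h2 := ih (n + 1) (by omega) (K + 1) (i - 2) (by push_cast at h ⊢; omega)
        have h3 := ih (n + 1) (by omega) K (i - 1) (by push_cast at h ⊢; omega)
        have h4 : ∑ j ∈ Finset.range (K + 1), t (n + 1) (i - 1) ((j : ℤ) - 1) * y ^ j
            = y * rowPoly (n + 1) y (i - 1) := by
          rw [Finset.sum_range_succ', t_eq_zero _ _ (((0 : ℕ) : ℤ) - 1) (by simp), ← h3,
            Finset.mul_sum]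
          simp only [zero_mul, add_zero]
          refine Finset.sum_congr rfl fun j _ => ?_
          rw [show ((j + 1 : ℕ) : ℤ) - 1 = j by push_cast; ring]
          ring
        rw [rowPoly, add_mul, ← h4, ← h1, ← h2, Finset.mul_sum, Finset.mul_sum,
          ← Finset.sum_add_distrib, ← Finset.sum_add_distrib]
        refine Finset.sum_congr rfl fun j _ => ?_
        rw [t_succ_succ]
        ring

/-- Lowering `σ₁` by one raises `y = -σ₁` by one; this difference equation is what matches the
removal of a point from a set. -/
theorem rowPoly_add_one_sub (n : ℕ) (y i : ℤ) :
    rowPoly (n + 1) (y + 1) i - rowPoly (n + 1) y i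
      = (i - 2) * rowPoly n (y + 1) (i - 1) := by
  induction n generalizing i with
  | zero => simp [rowPoly]
  | succ n ih =>
    have h1 := ih (i - 1)
    have h2 := ih (i - 2)
    -- `rowPoly 1` is an initial value and does not obey the recursion, but it is supported at `2`,
    -- where the factor `i - 3` vanishes.
    have h3 : (i - 3) * rowPoly (n + 1) (y + 1) (i - 1)
        = (i - 3) * ((i - 2 + y) * rowPoly n (y + 1) (i - 2)
          + (i - 4) * rowPoly n (y + 1) (i - 3)) := by
      cases n with
      | zero =>
        by_cases hi : i = 3
        · simp [hi]
        · simp [rowPoly, show i - 1 ≠ 2 by omega]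
      | succ n =>
        rw [rowPoly, sub_sub, sub_sub]
        norm_num only
        ring
    rw [show i - 1 - 1 = i - 2 by ring] at h1
    rw [show i - 2 - 1 = i - 3 by ring] at h2
    rw [rowPoly, rowPoly]
    linear_combination (i - 2 + y) * h1 + (i - 3) * h2 - h3

/-! ### Elementary symmetric functions of the sizes -/

/-- The generating polynomial `∏_k (1 + s_k X)`. -/
noncomputable def genPoly {n : ℕ} (s : Fin n → ℕ) : Polynomial ℤ :=
  ∏ k : Fin n, (1 + Polynomial.C (s k : ℤ) * Polynomial.X)

theorem sigma_eq_coeff {n : ℕ} (s : Fin n → ℕ) (j : ℕ) : sigma s j = (genPoly s).coeff j := rfl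

theorem sigma_zero {n : ℕ} (s : Fin n → ℕ) : sigma s 0 = 1 := by
  rw [sigma, Polynomial.coeff_zero_eq_eval_zero, Polynomial.eval_prod]
  simp

theorem sigma_of_lt {n : ℕ} (s : Fin n → ℕ) (j : ℕ) (h : n < j) : sigma s j = 0 := by
  refine Polynomial.coeff_eq_zero_of_natDegree_lt (lt_of_le_of_lt ?_ h)
  refine (Polynomial.natDegree_prod_le _ _).trans ?_
  refine (Finset.sum_le_card_nsmul _ _ 1 fun k _ => ?_).trans (by simp)
  compute_degree

theorem sigma_cons_succ {n : ℕ} (r : ℕ) (s : Fin n → ℕ) (j : ℕ) :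
    sigma (Fin.cons r s : Fin (n + 1) → ℕ) (j + 1) = sigma s (j + 1) + r * sigma s j := by
  simp only [sigma, Fin.prod_univ_succ, Fin.cons_zero, Fin.cons_succ]
  rw [add_mul, one_mul, mul_assoc, Polynomial.coeff_add, Polynomial.coeff_C_mul,
    Polynomial.coeff_X_mul]

/-- The changed factor is `(1 + sᵢX) + rX`. The first part restores `genPoly s`; the second leaves
`X` times the `i`-th term of the derivative. -/
theorem sum_mul_genPoly_update {n : ℕ} (r : ℕ) (s : Fin n → ℕ) :
    ∑ i, Polynomial.C (s i : ℤ) * genPoly (Function.update s i (r + s i))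
      = Polynomial.C (∑ i, (s i : ℤ)) * genPoly s
        + Polynomial.C (r : ℤ) * (Polynomial.X * Polynomial.derivative (genPoly s)) := by
  have hd : Polynomial.derivative (genPoly s) = ∑ i, Polynomial.C (s i : ℤ) *
      ∏ k ∈ Finset.univ.erase i, (1 + Polynomial.C (s k : ℤ) * Polynomial.X) := by
    rw [genPoly, Polynomial.derivative_prod_finset]
    refine Finset.sum_congr rfl fun i _ => ?_
    simp [mul_comm]
  rw [hd, map_sum, Finset.sum_mul, Finset.mul_sum, Finset.mul_sum, ← Finset.sum_add_distrib]
  refine Finset.sum_congr rfl fun i _ => ?_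
  have h1 : genPoly s = (1 + Polynomial.C (s i : ℤ) * Polynomial.X) *
      ∏ k ∈ Finset.univ.erase i, (1 + Polynomial.C (s k : ℤ) * Polynomial.X) :=
    (Finset.mul_prod_erase _ _ (Finset.mem_univ i)).symm
  have h2 : genPoly (Function.update s i (r + s i))
      = (1 + Polynomial.C ((r : ℤ) + s i) * Polynomial.X) *
      ∏ k ∈ Finset.univ.erase i, (1 + Polynomial.C (s k : ℤ) * Polynomial.X) := by
    rw [genPoly, ← Finset.mul_prod_erase _ _ (Finset.mem_univ i), Function.update_self]
    refine congrArg₂ (· * ·) (by simp) (Finset.prod_congr rfl fun k hk => ?_)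
    rw [Function.update_of_ne (Finset.ne_of_mem_erase hk)]
  rw [h1, h2, map_add]
  ring

theorem sigma_one {n : ℕ} (s : Fin n → ℕ) : sigma s 1 = ∑ i, (s i : ℤ) := by
  induction n with
  | zero => simp [sigma, Polynomial.coeff_one]
  | succ n ih =>
    rw [← Fin.cons_self_tail s, sigma_cons_succ, ih, sigma_zero, Fin.sum_univ_succ]
    simp only [Fin.cons_zero, Fin.cons_succ]
    ring

theorem sum_mul_sigma_update {n : ℕ} (r : ℕ) (s : Fin n → ℕ) (k : ℕ) :
    ∑ i, (s i : ℤ) * sigma (Function.update s i (r + s i)) k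
      = (sigma s 1 + r * k) * sigma s k := by
  have h := congrArg (fun p => Polynomial.coeff p k) (sum_mul_genPoly_update r s)
  simp only [Polynomial.finsetSum_coeff, Polynomial.coeff_C_mul, Polynomial.coeff_add] at h
  simp only [sigma_eq_coeff]
  rw [h, ← sigma_one, sigma_eq_coeff]
  cases k with
  | zero => simp
  | succ k =>
    rw [Polynomial.coeff_X_mul, Polynomial.coeff_derivative]
    push_cast
    ring

/-! ### The recursion for the coefficients of `U` -/

/-- The coefficient of `x^m` in `1 - U` at the values `σ`. -/
def correction (m : ℕ) (σ : ℕ → ℤ) : ℤ :=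
  ∑ i ∈ Finset.range (2 * m + 1), σ i * rowPoly m (-σ 1) i

theorem coeff_specializedU (m : ℕ) (σ : ℕ → ℤ) :
    PowerSeries.coeff m (specializedU σ) = (if m = 0 then 1 else 0) - correction m σ := by
  rw [specializedU, U, map_sub, map_one, map_sub, PowerSeries.coeff_one, PowerSeries.coeff_map,
    PowerSeries.coeff_mk, map_sum]
  congr 1
  rw [correction, ← Finset.sum_subset (s₁ := Finset.Icc (m + 1) (2 * m))
    (s₂ := Finset.range (2 * m + 1))]
  · refine Finset.sum_congr rfl fun i hi => ?_
    rw [Finset.mem_Icc] at hi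
    rw [map_mul, map_sum, MvPolynomial.eval_X, ← sum_t_mul_pow m (2 * m - i + 1) (-σ 1) i (by omega)]
    simp
  · intro i hi
    rw [Finset.mem_Icc] at hi
    rw [Finset.mem_range]
    omega
  · intro i hi hi'
    rw [Finset.mem_range] at hi
    rw [Finset.mem_Icc] at hi'
    rw [rowPoly_of_le m _ i (by omega), mul_zero]

theorem correction_zero (σ : ℕ → ℤ) : correction 0 σ = 0 := by
  simp [correction, rowPoly]

theorem coeff_zero_specializedU (σ : ℕ → ℤ) : PowerSeries.coeff 0 (specializedU σ) = 1 := by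
  rw [coeff_specializedU, correction_zero]; simp

theorem coeff_specializedU_sigma_eq_zero {n : ℕ} (s : Fin n → ℕ) (m : ℕ) (h : n ≤ m)
    (hm : m ≠ 0) : PowerSeries.coeff m (specializedU (sigma s)) = 0 := by
  rw [coeff_specializedU, if_neg hm, correction, Finset.sum_eq_zero, sub_zero]
  intro i _
  by_cases hi : i ≤ m
  · rw [rowPoly_of_le m _ i (by exact_mod_cast hi), mul_zero]
  · rw [sigma_of_lt s i (by omega), zero_mul]

/-- Summation by shift: both boundary terms vanish, being outside the support `m < i ≤ 2m` of the
row. -/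
theorem sum_sigma_cons_mul {n : ℕ} (r : ℕ) (s : Fin n → ℕ) (m : ℕ) (y : ℤ) :
    ∑ i ∈ Finset.range (2 * m + 1), sigma (Fin.cons r s : Fin (n + 1) → ℕ) i * rowPoly m y i
      = ∑ k ∈ Finset.range (2 * m + 1),
          sigma s k * (rowPoly m y k + r * rowPoly m y ((k : ℤ) + 1)) := by
  have h0 : rowPoly m y ((0 : ℕ) : ℤ) = 0 := rowPoly_of_le m y _ (by push_cast; omega)
  have h1 : rowPoly m y (((2 * m : ℕ) : ℤ) + 1) = 0 :=
    rowPoly_of_two_mul_lt m y _ (by push_cast; omega)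
  simp only [mul_add, Finset.sum_add_distrib]
  rw [Finset.sum_range_succ', Finset.sum_range_succ' (fun k => sigma s k * rowPoly m y (k : ℤ)),
    Finset.sum_range_succ (fun k => sigma s k * ((r : ℤ) * rowPoly m y ((k : ℤ) + 1))), h0, h1]
  simp only [mul_zero, add_zero, ← Finset.sum_add_distrib]
  refine Finset.sum_congr rfl fun k _ => ?_
  rw [sigma_cons_succ]
  push_cast
  ring

theorem sigma_cons_zero {n : ℕ} (s : Fin n → ℕ) :
    sigma (Fin.cons 0 s : Fin (n + 1) → ℕ) = sigma s := by
  funext j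
  cases j with
  | zero => rw [sigma_zero, sigma_zero]
  | succ j => rw [sigma_cons_succ]; simp

theorem sigma_update_one {n : ℕ} (r : ℕ) (s : Fin n → ℕ) (i : Fin n) :
    sigma (Function.update s i (r + s i)) 1 = r + sigma s 1 := by
  rw [sigma_one, sigma_one, ← Finset.add_sum_erase _ _ (Finset.mem_univ i),
    ← Finset.add_sum_erase _ (fun i => (s i : ℤ)) (Finset.mem_univ i), Function.update_self,
    Finset.sum_congr rfl fun k hk => by
      rw [Function.update_of_ne (Finset.ne_of_mem_erase hk)]]
  push_cast
  ring

theorem correction_recursion {n : ℕ} (r : ℕ) (s : Fin n → ℕ) (m : ℕ) :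
    correction (m + 2) (sigma (Fin.cons (r + 1) s : Fin (n + 1) → ℕ))
      = correction (m + 2) (sigma (Fin.cons r s : Fin (n + 1) → ℕ))
        - ∑ i, (s i : ℤ) * correction (m + 1) (sigma (Function.update s i (r + s i))) := by
  have hm : ∑ i, (s i : ℤ) * correction (m + 1) (sigma (Function.update s i (r + s i)))
      = ∑ k ∈ Finset.range (2 * (m + 2) + 1), (sigma s 1 + r * k) * sigma s k *
          rowPoly (m + 1) (-(r + sigma s 1)) k := by
    rw [show 2 * (m + 2) + 1 = 2 * (m + 1) + 1 + 1 + 1 by ring, Finset.sum_range_succ,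
      Finset.sum_range_succ, rowPoly_of_two_mul_lt (m + 1) _ _ (by push_cast; omega),
      rowPoly_of_two_mul_lt (m + 1) _ _ (by push_cast; omega), mul_zero, mul_zero, add_zero,
      add_zero]
    simp only [correction, sigma_update_one, Finset.mul_sum]
    rw [Finset.sum_comm]
    refine Finset.sum_congr rfl fun k _ => ?_
    rw [← sum_mul_sigma_update, Finset.sum_mul]
    exact Finset.sum_congr rfl fun i _ => by ring
  rw [hm, correction, correction, sum_sigma_cons_mul, sum_sigma_cons_mul,
    ← Finset.sum_sub_distrib]
  refine Finset.sum_congr rfl fun k _ => ?_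
  rw [sigma_cons_succ, sigma_cons_succ, sigma_zero]
  set y : ℤ := -(sigma s 1 + ((r + 1 : ℕ) : ℤ) * 1) with hy
  -- The families with sizes `(r, s)` and all the fused ones have the same total size, so their rows
  -- are evaluated at the same point `y + 1`.
  have e1 : -(sigma s 1 + (r : ℤ) * 1) = y + 1 := by rw [hy]; push_cast; ring
  have e2 : -((r : ℤ) + sigma s 1) = y + 1 := by rw [hy]; push_cast; ring
  simp only [zero_add] at *
  rw [e1, e2]
  have e3 : sigma s 1 = -y - r - 1 := by rw [hy]; push_cast; ring
  -- The identity holds for each coefficient of `sigma s k`: two difference equations, and the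
  -- defining recursion at `k + 1` to absorb the surplus row.
  have a1 := rowPoly_add_one_sub (m + 1) y k
  have a2 := rowPoly_add_one_sub (m + 1) y ((k : ℤ) + 1)
  have a3 : rowPoly (m + 2) (y + 1) ((k : ℤ) + 1) = ((k : ℤ) + 1 - 2 + (y + 1)) *
      rowPoly (m + 1) (y + 1) ((k : ℤ) + 1 - 1)
      + ((k : ℤ) + 1 - 3) * rowPoly (m + 1) (y + 1) ((k : ℤ) + 1 - 2) := by rw [rowPoly]
  rw [show (k : ℤ) + 1 - 1 = k by ring] at a2 a3
  rw [show (k : ℤ) + 1 - 2 = k - 1 by ring] at a3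
  rw [show m + 1 + 1 = m + 2 by ring] at a1 a2
  rw [e3]
  push_cast
  linear_combination sigma s k * (-a1 - (r + 1) * a2 + a3)

theorem coeff_specializedU_recursion {n : ℕ} (r : ℕ) (s : Fin n → ℕ) (m : ℕ) :
    PowerSeries.coeff (m + 1) (specializedU (sigma (Fin.cons (r + 1) s : Fin (n + 1) → ℕ)))
      = PowerSeries.coeff (m + 1) (specializedU (sigma (Fin.cons r s : Fin (n + 1) → ℕ)))
        - ∑ i, (s i : ℤ) *
          PowerSeries.coeff m (specializedU (sigma (Function.update s i (r + s i)))) := by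
  cases m with
  | zero =>
    simp only [coeff_zero_specializedU, mul_one]
    rw [← sigma_one, coeff_specializedU, coeff_specializedU]
    simp [correction, rowPoly, Finset.sum_range_succ, sigma_cons_succ]
    ring
  | succ m =>
    simp only [coeff_specializedU, correction_recursion]
    simp [Finset.sum_neg_distrib]
    ring

/-! ### The packing polynomial -/

/-- The polynomial counting the packings of a generic family of sets of sizes `s`. -/
noncomputable def packingPoly {n : ℕ} (s : Fin n → ℕ) : Polynomial ℤ :=
  ∑ m ∈ Finset.range (n + 1),
    Polynomial.C (PowerSeries.coeff m (specializedU (sigma s))) * Polynomial.X ^ (n - m)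

theorem eval_packingPoly {n : ℕ} (s : Fin n → ℕ) (N : ℤ) :
    (packingPoly s).eval N = ∑ m ∈ Finset.range (n + 1),
      PowerSeries.coeff m (specializedU (sigma s)) * N ^ (n - m) := by
  simp [packingPoly, Polynomial.eval_finsetSum]

theorem degree_packingPoly {n : ℕ} (s : Fin n → ℕ) : (packingPoly s).degree = n := by
  rw [packingPoly, Finset.sum_range_succ', coeff_zero_specializedU, map_one, one_mul,
    Nat.sub_zero, Polynomial.degree_add_eq_right_of_degree_lt]
  · simp
  · rw [Polynomial.degree_X_pow]
    refine (Polynomial.degree_sum_le _ _).trans_lt ?_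
    rw [Finset.sup_lt_iff (by exact WithBot.bot_lt_coe n)]
    intro m hm
    refine (Polynomial.degree_C_mul_X_pow_le _ _).trans_lt ?_
    rw [Finset.mem_range] at hm
    exact_mod_cast (show n - (m + 1) < n by omega)

theorem eval_packingPoly_eq_evalU {n : ℕ} (s : Fin n → ℕ) (N : ℕ) (hN : 0 < N) :
    (((packingPoly s).eval (N : ℤ) : ℤ) : ℝ) = (N : ℝ) ^ n * evalU ((N : ℝ)⁻¹) (sigma s) := by
  have hN' : (N : ℝ) ≠ 0 := by positivity
  rw [evalU, tsum_eq_sum (s := Finset.range (n + 1)), eval_packingPoly, Finset.mul_sum]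
  · push_cast
    refine Finset.sum_congr rfl fun m hm => ?_
    rw [Finset.mem_range] at hm
    rw [pow_sub₀ _ hN' (by omega), inv_pow]
    ring
  · intro m hm
    rw [Finset.mem_range] at hm
    rw [coeff_specializedU_sigma_eq_zero s m (by omega) (by omega)]
    simp

theorem eval_packingPoly_cons_zero {n : ℕ} (s : Fin n → ℕ) (N : ℤ) :
    (packingPoly (Fin.cons 0 s : Fin (n + 1) → ℕ)).eval N = N * (packingPoly s).eval N := by
  rw [eval_packingPoly, eval_packingPoly, sigma_cons_zero, Finset.sum_range_succ,
    coeff_specializedU_sigma_eq_zero s (n + 1) (by omega) (by omega), zero_mul, add_zero,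
    Finset.mul_sum]
  refine Finset.sum_congr rfl fun m hm => ?_
  rw [Finset.mem_range] at hm
  rw [show n + 1 - m = n - m + 1 by omega]
  ring

theorem eval_packingPoly_recursion {n : ℕ} (r : ℕ) (s : Fin n → ℕ) (N : ℤ) :
    (packingPoly (Fin.cons (r + 1) s : Fin (n + 1) → ℕ)).eval N
      = (packingPoly (Fin.cons r s : Fin (n + 1) → ℕ)).eval N
        - ∑ i, (s i : ℤ) * (packingPoly (Function.update s i (r + s i))).eval N := by
  simp only [eval_packingPoly]
  rw [Finset.sum_range_succ', Finset.sum_range_succ' _ (n + 1)]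
  simp only [coeff_specializedU_recursion, coeff_zero_specializedU, Finset.mul_sum]
  rw [Finset.sum_comm, add_sub_right_comm, ← Finset.sum_sub_distrib]
  congr 1
  refine Finset.sum_congr rfl fun m _ => ?_
  rw [Nat.add_sub_add_right, sub_mul, Finset.sum_mul]
  congr 1
  exact Finset.sum_congr rfl fun i _ => by ring

end GroupPacking

namespace GroupPacking

/-! ### Generic families and fusion -/

section Group

variable {G : Type*} [Group G] {n : ℕ}

/-- Deleting the trivial factors leaves a product that genericity forbids, unless nothing is left.
-/
theorem IsGeneric.eq_one_of_prod_eq_one {S : Fin n → Set G} (hS : IsGeneric S)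
    (l : List (Fin n)) (hl : l.Nodup) (h : Fin n → G) (hh : ∀ i ∈ l, h i ∈ (S i)⁻¹ * S i)
    (hp : (l.map h).prod = 1) : ∀ i ∈ l, h i = 1 := by
  classical
  have key : ∀ l : List (Fin n),
      ((l.filter fun i => h i ≠ 1).map h).prod = (l.map h).prod := by
    intro l
    induction l with
    | nil => rfl
    | cons a l ih =>
      by_cases ha : h a = 1
      · simpa [ha] using ih
      · simpa [ha] using ih
  intro i hi
  by_contra hne
  refine hS (l.filter fun i => h i ≠ 1) ?_ (hl.filter _) h ?_ ((key l).trans hp)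
  · exact List.ne_nil_of_mem (List.mem_filter.2 ⟨hi, by simpa using hne⟩)
  · intro j hj
    obtain ⟨h1, h2⟩ := List.mem_filter.1 hj
    exact ⟨hh j h1, by simpa using h2⟩

theorem IsGeneric.mono {S T : Fin n → Set G} (hS : IsGeneric S) (h : ∀ i, T i ⊆ S i) :
    IsGeneric T := fun l hl hd f hf =>
  hS l hl hd f fun i hi =>
    ⟨Set.mul_subset_mul (Set.inv_subset_inv.2 (h i)) (h i) (hf i hi).1, (hf i hi).2⟩

theorem IsGeneric.tail {S₀ : Set G} {S : Fin n → Set G}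
    (hS : IsGeneric (Fin.cons S₀ S : Fin (n + 1) → Set G)) : IsGeneric S := by
  intro l hl hd h hh
  have := hS (l.map Fin.succ) (by simpa using hl) (hd.map (Fin.succ_injective n))
    (Fin.cons 1 h) (by simpa using hh)
  simpa [Function.comp_def] using this

/-- The union of the translates of `S₀` and `S₁` that move `a` and `b` to the identity, with the
contribution of `a` omitted. -/
def glue (S₀ S₁ : Set G) (a b : G) : Set G := a⁻¹ • (S₀ \ {a}) ∪ b⁻¹ • S₁

/-- A quotient of two points in different pieces passes through the identity, the common image of
`a` and `b`; within one piece the other factor is `1`. -/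
theorem mem_inv_mul_glue {S₀ S₁ : Set G} {a b x : G} (ha : a ∈ S₀) (hb : b ∈ S₁)
    (hx : x ∈ (glue S₀ S₁ a b)⁻¹ * glue S₀ S₁ a b) :
    ∃ u ∈ S₀⁻¹ * S₀, ∃ v ∈ S₁⁻¹ * S₁, x = u * v ∨ x = v * u := by
  obtain ⟨y, hy, z, hz, rfl⟩ := Set.mem_mul.1 hx
  have h₀ : (1 : G) ∈ S₀⁻¹ * S₀ := ⟨a⁻¹, by simpa using ha, a, ha, by simp⟩
  have h₁ : (1 : G) ∈ S₁⁻¹ * S₁ := ⟨b⁻¹, by simpa using hb, b, hb, by simp⟩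
  rw [Set.mem_inv] at hy
  have split : ∀ w ∈ glue S₀ S₁ a b, (∃ c ∈ S₀, w = a⁻¹ * c) ∨ ∃ c ∈ S₁, w = b⁻¹ * c := by
    rintro w (⟨c, hc, rfl⟩ | ⟨c, hc, rfl⟩)
    · exact Or.inl ⟨c, hc.1, rfl⟩
    · exact Or.inr ⟨c, hc, rfl⟩
  rcases split _ hy with ⟨c, hc, hyc⟩ | ⟨c, hc, hyc⟩ <;>
    rcases split _ hz with ⟨d, hd, rfl⟩ | ⟨d, hd, rfl⟩ <;>
    obtain rfl : y = _ := inv_eq_iff_eq_inv.1 hyc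
  · exact ⟨c⁻¹ * d, ⟨_, by simpa using hc, _, hd, rfl⟩, 1, h₁, Or.inl (by group)⟩
  · exact ⟨c⁻¹ * a, ⟨_, by simpa using hc, _, ha, rfl⟩, b⁻¹ * d,
      ⟨_, by simpa using hb, _, hd, rfl⟩, Or.inl (by group)⟩
  · exact ⟨a⁻¹ * d, ⟨_, by simpa using ha, _, hd, rfl⟩, c⁻¹ * b,
      ⟨_, by simpa using hc, _, hb, rfl⟩, Or.inr (by group)⟩
  · exact ⟨1, h₀, c⁻¹ * d, ⟨_, by simpa using hc, _, hd, rfl⟩, Or.inl (by group)⟩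

/-- In a word using the fused set once, its letter splits into a letter of `S₀` and one of `S i`, in
some order. The result is a word in distinct letters of the original family, so both new letters are
trivial. -/
theorem IsGeneric.update_glue {S₀ : Set G} {S : Fin n → Set G}
    (hS : IsGeneric (Fin.cons S₀ S : Fin (n + 1) → Set G)) {a b : G} (i : Fin n) (ha : a ∈ S₀)
    (hb : b ∈ S i) : IsGeneric (Function.update S i (glue S₀ (S i) a b)) := by
  intro l hl hd h hh hp
  by_cases hi : i ∈ l
  · obtain ⟨l₁, l₂, rfl⟩ := List.append_of_mem hi
    have hi' := hh i hi
    rw [Function.update_self] at hi'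
    obtain ⟨u, hu, v, hv, huv⟩ := mem_inv_mul_glue ha hb hi'.1
    have hd' := hd
    rw [List.nodup_middle, List.nodup_cons, List.mem_append, not_or] at hd'
    obtain ⟨⟨hi₁, hi₂⟩, -⟩ := hd'
    set f : Fin (n + 1) → G := Fin.cons u (Function.update h i v) with hf
    have hf0 : f 0 = u := rfl
    have hfi : f i.succ = v := by simp [hf]
    have hfs : ∀ j, j ≠ i → f j.succ = h j := fun j hj => by simp [hf, hj]
    have hmap : ∀ l : List (Fin n), i ∉ l → (l.map Fin.succ).map f = l.map h := by
      intro l hil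
      rw [List.map_map]
      exact List.map_congr_left fun j hj => hfs j fun e => hil (e ▸ hj)
    have hmem : ∀ j, (j = 0 ∨ j = i.succ ∨ ∃ k, (k ∈ l₁ ∨ k ∈ l₂) ∧ k.succ = j) →
        f j ∈ ((Fin.cons S₀ S : Fin (n + 1) → Set G) j)⁻¹ *
          (Fin.cons S₀ S : Fin (n + 1) → Set G) j := by
      rintro j (rfl | rfl | ⟨k, hk, rfl⟩)
      · simpa [hf0] using hu
      · simpa [hfi] using hv
      · have hki : k ≠ i := by rintro rfl; tauto
        have := (hh k (by simp; tauto)).1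
        rw [Function.update_of_ne hki] at this
        simpa [hfs k hki] using this
    have hone : u = 1 ∧ v = 1 := by
      rw [List.map_append, List.map_cons, List.prod_append, List.prod_cons] at hp
      have hs := Fin.succ_injective n
      have hnd := (List.nodup_middle.1 hd).map hs
      rw [List.map_cons, List.map_append] at hnd
      rcases huv with huv | huv
      · have := hS.eq_one_of_prod_eq_one (l₁.map Fin.succ ++ 0 :: i.succ :: l₂.map Fin.succ)
          (by
            rw [List.nodup_middle, List.nodup_cons]
            refine ⟨by simp [Fin.succ_ne_zero, (Fin.succ_ne_zero _).symm], ?_⟩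
            rwa [List.nodup_middle]) f
          (by
            intro j hj
            apply hmem
            simp only [List.mem_append, List.mem_cons, List.mem_map] at hj
            grind)
          (by
            rw [List.map_append, List.map_cons, List.map_cons, hmap l₁ hi₁, hmap l₂ hi₂, hf0, hfi,
              List.prod_append, List.prod_cons, List.prod_cons, ← mul_assoc u, ← huv, hp])
        exact ⟨hf0 ▸ this 0 (by simp), hfi ▸ this i.succ (by simp)⟩
      · have := hS.eq_one_of_prod_eq_one (l₁.map Fin.succ ++ i.succ :: 0 :: l₂.map Fin.succ)
          (by
            rw [List.nodup_middle, ← List.cons_append, List.nodup_middle, List.nodup_cons]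
            exact ⟨by simp [Fin.succ_ne_zero, (Fin.succ_ne_zero _).symm], hnd⟩) f
          (by
            intro j hj
            apply hmem
            simp only [List.mem_append, List.mem_cons, List.mem_map] at hj
            grind)
          (by
            rw [List.map_append, List.map_cons, List.map_cons, hmap l₁ hi₁, hmap l₂ hi₂, hf0, hfi,
              List.prod_append, List.prod_cons, List.prod_cons, ← mul_assoc v, ← huv, hp])
        exact ⟨hf0 ▸ this 0 (by simp), hfi ▸ this i.succ (by simp)⟩
    apply hi'.2
    rcases huv with huv | huv <;> simp [huv, hone.1, hone.2]
  · refine hS.tail l hl hd h (fun j hj => ?_) hp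
    have := hh j hj
    rwa [Function.update_of_ne (by rintro rfl; exact hi hj)] at this

/-- Translates of two members of a generic family through a common point meet only there. -/
theorem IsGeneric.eq_of_inv_mul_eq {S₀ : Set G} {S : Fin n → Set G}
    (hS : IsGeneric (Fin.cons S₀ S : Fin (n + 1) → Set G)) {a b c d : G} {i : Fin n}
    (ha : a ∈ S₀) (hb : b ∈ S i) (hc : c ∈ S₀) (hd : d ∈ S i) (h : a⁻¹ * c = b⁻¹ * d) :
    c = a := by
  have := hS.eq_one_of_prod_eq_one [0, i.succ] (by simp [(Fin.succ_ne_zero _).symm])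
    (Fin.cons (a⁻¹ * c) fun _ => d⁻¹ * b)
    (by
      intro j hj
      simp only [List.mem_cons, List.not_mem_nil, or_false] at hj
      rcases hj with rfl | rfl
      · exact ⟨_, by simpa using ha, _, hc, rfl⟩
      · exact ⟨_, by simpa using hd, _, hb, rfl⟩)
    (by simp [h]) 0 (by simp)
  exact (inv_mul_eq_one.1 this).symm

theorem IsGeneric.disjoint_glue {S₀ : Set G} {S : Fin n → Set G}
    (hS : IsGeneric (Fin.cons S₀ S : Fin (n + 1) → Set G)) {a b : G} {i : Fin n}
    (ha : a ∈ S₀) (hb : b ∈ S i) : Disjoint (a⁻¹ • (S₀ \ {a})) (b⁻¹ • S i) := by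
  rw [Set.disjoint_left]
  rintro _ ⟨c, hc, rfl⟩ ⟨d, hd, h⟩
  exact hc.2 (hS.eq_of_inv_mul_eq ha hb hc.1 hd h.symm)

theorem IsGeneric.ncard_glue [Finite G] {S₀ : Set G} {S : Fin n → Set G}
    (hS : IsGeneric (Fin.cons S₀ S : Fin (n + 1) → Set G)) {a b : G} {i : Fin n}
    (ha : a ∈ S₀) (hb : b ∈ S i) :
    (glue S₀ (S i) a b).ncard = (S₀ \ {a}).ncard + (S i).ncard := by
  rw [glue, Set.ncard_union_eq (hS.disjoint_glue ha hb), Set.ncard_smul_set, Set.ncard_smul_set]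

/-! ### Counting packings -/

theorem isPacking_cons {S₀ : Set G} {S : Fin n → Set G} {g₀ : G} {g : Fin n → G} :
    IsPacking (Fin.cons S₀ S : Fin (n + 1) → Set G) (Fin.cons g₀ g) ↔
      IsPacking S g ∧ ∀ i, Disjoint (g₀ • S₀) (g i • S i) := by
  constructor
  · intro h
    refine ⟨fun i j hij => ?_, fun i => ?_⟩
    · simpa using h (i := i.succ) (j := j.succ) (by simpa using hij)
    · simpa using h (i := 0) (j := i.succ) (Fin.succ_ne_zero i).symm
  · rintro ⟨h, h₀⟩ i j hij
    cases i using Fin.cases with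
    | zero =>
      cases j using Fin.cases with
      | zero => exact absurd rfl hij
      | succ j => simpa using h₀ j
    | succ i =>
      cases j using Fin.cases with
      | zero => simpa using (h₀ i).symm
      | succ j => simpa using h (i := i) (j := j) (by rintro rfl; exact hij rfl)

theorem numPackings_cons (S₀ : Set G) (S : Fin n → Set G) :
    numPackings (Fin.cons S₀ S : Fin (n + 1) → Set G) =
      Nat.card {p : G × (Fin n → G) //
        IsPacking S p.2 ∧ ∀ i, Disjoint (p.1 • S₀) (p.2 i • S i)} := by
  refine Nat.card_congr ((Fin.consEquiv fun _ => G).subtypeEquiv fun p => ?_).symm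
  exact isPacking_cons.symm

theorem numPackings_cons_empty (S : Fin n → Set G) :
    numPackings (Fin.cons ∅ S : Fin (n + 1) → Set G) = Nat.card G * numPackings S := by
  rw [numPackings_cons, numPackings, ← Nat.card_prod]
  refine Nat.card_congr ⟨fun p => (p.1.1, ⟨p.1.2, p.2.1⟩), fun q => ⟨(q.1, q.2.1), q.2.2, ?_⟩,
    fun _ => rfl, fun _ => rfl⟩
  simp

/-- Translating the fused set by `g i` moves `S₀ \ {a}` by `g i * a⁻¹` and `S i` by `g i * b⁻¹`: the
points `a` and `b` would both land on `g i`. -/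
theorem isPacking_update_glue {S₀ : Set G} {S : Fin n → Set G}
    (hS : IsGeneric (Fin.cons S₀ S : Fin (n + 1) → Set G)) {a b : G} {i : Fin n}
    (ha : a ∈ S₀) (hb : b ∈ S i) (g : Fin n → G) :
    IsPacking (Function.update S i (glue S₀ (S i) a b)) g ↔
      IsPacking S (Function.update g i (g i * b⁻¹)) ∧
        ∀ j, Disjoint ((g i * a⁻¹) • (S₀ \ {a})) (Function.update g i (g i * b⁻¹) j • S j) := by
  have hglue : g i • glue S₀ (S i) a b
      = (g i * a⁻¹) • (S₀ \ {a}) ∪ (g i * b⁻¹) • S i := by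
    rw [glue, Set.smul_set_union, smul_smul, smul_smul]
  constructor
  · intro h
    have hi : ∀ j, j ≠ i → Disjoint ((g i * a⁻¹) • (S₀ \ {a})) (g j • S j) ∧
        Disjoint ((g i * b⁻¹) • S i) (g j • S j) := by
      intro j hj
      have : Disjoint (g i • Function.update S i (glue S₀ (S i) a b) i)
          (g j • Function.update S i (glue S₀ (S i) a b) j) := h hj.symm
      rwa [Function.update_self, Function.update_of_ne hj, hglue, Set.disjoint_union_left] at this
    refine ⟨fun j k hjk => ?_, fun j => ?_⟩
    · by_cases hj : j = i
      · subst hj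
        simpa [Function.update_of_ne hjk.symm] using (hi k hjk.symm).2
      · by_cases hk : k = i
        · subst hk
          simpa [Function.update_of_ne hjk] using (hi j hjk).2.symm
        · simpa [hj, hk] using h hjk
    · by_cases hj : j = i
      · subst hj
        rw [Function.update_self, ← smul_smul, ← smul_smul]
        exact Set.disjoint_smul_set.2 (hS.disjoint_glue ha hb)
      · simpa [hj] using (hi j hj).1
  · rintro ⟨h, h₀⟩
    have hi : ∀ j, j ≠ i → Disjoint (g i • glue S₀ (S i) a b) (g j • S j) := by
      intro j hj
      have h1 := h₀ j
      have h2 := h hj.symm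
      rw [Function.update_of_ne hj] at h1 h2
      rw [Function.update_self] at h2
      rw [hglue, Set.disjoint_union_left]
      exact ⟨h1, h2⟩
    intro j k hjk
    by_cases hj : j = i
    · subst hj
      simpa [Function.update_of_ne hjk.symm] using hi k hjk.symm
    · by_cases hk : k = i
      · subst hk
        simpa [Function.update_of_ne hjk] using (hi j hjk).symm
      · simpa [hj, hk] using h hjk

theorem numPackings_cons_diff [Finite G] {S₀ : Set G} {S : Fin n → Set G}
    (hS : IsGeneric (Fin.cons S₀ S : Fin (n + 1) → Set G)) {a : G} (ha : a ∈ S₀) :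
    numPackings (Fin.cons (S₀ \ {a}) S : Fin (n + 1) → Set G)
      = numPackings (Fin.cons S₀ S : Fin (n + 1) → Set G)
        + Nat.card (Σ x : (Σ i, S i), {g : Fin n → G //
            IsPacking (Function.update S x.1 (glue S₀ (S x.1) a x.2)) g}) := by
  classical
  have hiff : ∀ p : G × (Fin n → G), (∀ i, Disjoint (p.1 • S₀) (p.2 i • S i)) ↔
      (∀ i, Disjoint (p.1 • (S₀ \ {a})) (p.2 i • S i)) ∧ ∀ i, p.1 * a ∉ p.2 i • S i := by
    intro p
    rw [← forall_and]
    refine forall_congr' fun i => ?_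
    rw [← Set.disjoint_singleton_left, ← smul_eq_mul, ← Set.smul_set_singleton,
      ← Set.disjoint_union_left, ← Set.smul_set_union, Set.sdiff_union_self,
      Set.union_eq_left.2 (Set.singleton_subset_iff.2 ha)]
  rw [numPackings_cons, numPackings_cons]
  set Q : G × (Fin n → G) → Prop := fun p =>
    IsPacking S p.2 ∧ ∀ i, Disjoint (p.1 • (S₀ \ {a})) (p.2 i • S i) with hQ
  set R : G × (Fin n → G) → Prop := fun p => ∀ i, p.1 * a ∉ p.2 i • S i with hR
  have e1 : Nat.card {p : G × (Fin n → G) //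
      IsPacking S p.2 ∧ ∀ i, Disjoint (p.1 • S₀) (p.2 i • S i)}
      = Nat.card {p : {p // Q p} // R p.1} := by
    refine Nat.card_congr (((Equiv.subtypeSubtypeEquivSubtypeInter Q R).trans
      (Equiv.subtypeEquivRight fun p => ?_)).symm)
    rw [hiff, and_assoc]
  rw [e1, ← Nat.card_congr (Equiv.sumCompl fun p : {p // Q p} => R p.1), Nat.card_sum]
  congr 1
  have hf : ∀ x : (Σ x : (Σ i, S i), {g : Fin n → G //
        IsPacking (Function.update S x.1 (glue S₀ (S x.1) a x.2)) g}),
      Q (x.2.1 x.1.1 * a⁻¹, Function.update x.2.1 x.1.1 (x.2.1 x.1.1 * (x.1.2 : G)⁻¹)) := fun x =>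
    (isPacking_update_glue hS ha x.1.2.2 x.2.1).1 x.2.2
  have hmem : ∀ x : (Σ x : (Σ i, S i), {g : Fin n → G //
        IsPacking (Function.update S x.1 (glue S₀ (S x.1) a x.2)) g}),
      x.2.1 x.1.1 * a⁻¹ * a ∈
        Function.update x.2.1 x.1.1 (x.2.1 x.1.1 * (x.1.2 : G)⁻¹) x.1.1 • S x.1.1 := fun x =>
    ⟨x.1.2, x.1.2.2, by simp⟩
  refine (Nat.card_congr (Equiv.ofBijective
    (fun x => ⟨⟨_, hf x⟩, fun h => h x.1.1 (hmem x)⟩) ⟨?_, ?_⟩)).symm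
  · rintro x y hxy
    simp only [Subtype.mk.injEq, Prod.mk.injEq] at hxy
    obtain ⟨h1, h2⟩ := hxy
    -- The point `g₀ a` cannot lie in two disjoint translates, so the index is determined; then `b`
    -- and the translations are too.
    have hi : x.1.1 = y.1.1 := by
      by_contra hne
      have hy := hmem y
      rw [← h1, ← h2] at hy
      exact Set.disjoint_left.1 ((hf x).1 hne) (hmem x) hy
    obtain ⟨⟨i, b, hb⟩, g, hg⟩ := x
    obtain ⟨⟨j, c, hc⟩, k, hk⟩ := y
    dsimp only at hi h1 h2 hg hk
    subst hi
    have h3 : g i = k i := mul_right_cancel h1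
    have h4 := congrFun h2 i
    simp only [Function.update_self, h3, mul_right_inj, inv_inj] at h4
    subst h4
    have h5 : g = k := by
      funext j
      by_cases hj : j = i
      · rw [hj, h3]
      · simpa [hj] using congrFun h2 j
    subst h5
    rfl
  · rintro ⟨⟨⟨g₀, g⟩, hg⟩, hr⟩
    simp only [hR, not_forall, not_not] at hr
    obtain ⟨i, b, hb, hib⟩ := hr
    -- This common point is where the fused set has to be placed.
    change g i * b = g₀ * a at hib
    have e2 : Function.update (Function.update g i (g i * b)) i
        (Function.update g i (g i * b) i * b⁻¹) = g := by simp
    have e3 : Function.update g i (g i * b) i * a⁻¹ = g₀ := by simp [hib]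
    refine ⟨⟨⟨i, b, hb⟩, Function.update g i (g i * b), ?_⟩, ?_⟩
    · refine (isPacking_update_glue hS ha hb _).2 ?_
      rw [e2, e3]
      exact hg
    · simp only [Subtype.mk.injEq, Prod.mk.injEq]
      exact ⟨e3, e2⟩

theorem numPackings_eq_eval [Finite G] (S : Fin n → Set G) (hS : IsGeneric S) :
    (numPackings S : ℤ) = (packingPoly fun i => (S i).ncard).eval (Nat.card G : ℤ) := by
  induction n with
  | zero =>
    have h : ∀ g : Fin 0 → G, IsPacking S g := fun g i => i.elim0
    rw [numPackings, Nat.card_congr (Equiv.subtypeUnivEquiv h), eval_packingPoly]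
    simp [coeff_zero_specializedU]
  | succ n ih =>
    have hcons : ∀ (S₀ : Set G) (S : Fin n → Set G),
        (fun i => ((Fin.cons S₀ S : Fin (n + 1) → Set G) i).ncard)
          = (Fin.cons S₀.ncard fun i => (S i).ncard : Fin (n + 1) → ℕ) := by
      intro S₀ S
      funext i
      cases i using Fin.cases <;> rfl
    obtain ⟨S₀, S, rfl⟩ : ∃ S₀ T, S = (Fin.cons S₀ T : Fin (n + 1) → Set G) :=
      ⟨S 0, Fin.tail S, (Fin.cons_self_tail S).symm⟩
    rw [hcons]
    -- The inner induction removes points of `S₀` down to the empty set, whose translation is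
    -- unconstrained and contributes a factor `N`. The outer hypothesis covers the fused families of
    -- `n` sets.
    induction hr : S₀.ncard generalizing S₀ with
    | zero =>
      obtain rfl := (Set.ncard_eq_zero).1 hr
      rw [numPackings_cons_empty, eval_packingPoly_cons_zero, ← ih S hS.tail]
      push_cast
      rfl
    | succ r ihr =>
      obtain ⟨a, ha⟩ : S₀.Nonempty := (Set.ncard_pos).1 (by omega)
      have hr' : (S₀ \ {a}).ncard = r := by
        rw [Set.ncard_sdiff_singleton_of_mem ha, hr, Nat.add_sub_cancel]
      have hgen : IsGeneric (Fin.cons (S₀ \ {a}) S : Fin (n + 1) → Set G) := by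
        refine hS.mono fun i => ?_
        cases i using Fin.cases with
        | zero => exact Set.sdiff_subset
        | succ i => exact subset_rfl
      have hmerge : (Nat.card (Σ x : (Σ i, S i), {g : Fin n → G //
          IsPacking (Function.update S x.1 (glue S₀ (S x.1) a x.2)) g}) : ℤ)
          = ∑ i, ((S i).ncard : ℤ) * (packingPoly (Function.update (fun i => (S i).ncard) i
              (r + (S i).ncard))).eval (Nat.card G : ℤ) := by
        classical
        have : Fintype G := Fintype.ofFinite G
        rw [Nat.card_sigma, Fintype.sum_sigma]
        push_cast
        refine Finset.sum_congr rfl fun i _ => ?_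
        have hb : ∀ b : S i, (Nat.card {g : Fin n → G //
            IsPacking (Function.update S i (glue S₀ (S i) a b)) g} : ℤ)
            = (packingPoly (Function.update (fun i => (S i).ncard) i
              (r + (S i).ncard))).eval (Nat.card G : ℤ) := by
          intro b
          have h := ih _ (hS.update_glue i ha b.2)
          rw [numPackings] at h
          rw [h]
          congr 2
          funext j
          by_cases hj : j = i
          · subst hj
            simp [hS.ncard_glue ha b.2, hr']
          · simp [hj]
        rw [Finset.sum_congr rfl fun b _ => hb b, Finset.sum_const, Finset.card_univ,
          ← Nat.card_eq_fintype_card, Nat.card_coe_set_eq, nsmul_eq_mul]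
      have h1 := numPackings_cons_diff hS ha
      have h2 := ihr _ hgen hr'
      rw [eval_packingPoly_recursion, ← h2, ← hmerge, h1]
      push_cast
      ring

end Group

end GroupPacking

theorem theorem2p1 (n : ℕ) :
    (∀ (G : Type u) [Group G] [Finite G] (S : Fin n → Set G),
      (∀ i, (S i).Nonempty) → GroupPacking.IsGeneric S →
        (GroupPacking.numPackings S : ℝ) =
          (Nat.card G : ℝ) ^ n *
            GroupPacking.evalU ((Nat.card G : ℝ)⁻¹)
              (GroupPacking.sigma fun i => (S i).ncard)) ∧
    (∀ s : Fin n → ℕ, (∀ i, 0 < s i) →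
      (∀ m : ℕ, n ≤ m → m ≠ 0 →
        PowerSeries.coeff m (GroupPacking.specializedU (GroupPacking.sigma s)) = 0) ∧
      ∃ P : Polynomial ℤ, P.degree = n ∧
        (∀ N : ℕ, 0 < N →
          ((P.eval (N : ℤ) : ℤ) : ℝ) =
            (N : ℝ) ^ n * GroupPacking.evalU ((N : ℝ)⁻¹) (GroupPacking.sigma s)) ∧
        ∀ (G : Type u) [Group G] [Finite G] (S : Fin n → Set G),
          (∀ i, (S i).ncard = s i) → GroupPacking.IsGeneric S →
            (GroupPacking.numPackings S : ℤ) = P.eval (Nat.card G : ℤ)) := by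
  refine ⟨fun G _ _ S _ hS => ?_, fun s _ => ⟨fun m hm hm' =>
    GroupPacking.coeff_specializedU_sigma_eq_zero s m hm hm', GroupPacking.packingPoly s,
    GroupPacking.degree_packingPoly s, fun N hN =>
    GroupPacking.eval_packingPoly_eq_evalU s N hN, fun G _ _ S hs hS => ?_⟩⟩
  · rw [← GroupPacking.eval_packingPoly_eq_evalU _ _ Nat.card_pos,
      ← GroupPacking.numPackings_eq_eval S hS]
    norm_cast
  · rw [GroupPacking.numPackings_eq_eval S hS, funext hs]
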